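/- Let $d\ge 1$ and let $L$ be a finite set of hyperplanes in $\mathbb{R}^d$ inducing a simple arrangement: for every $k\le d$, any $k$ hyperplanes of $L$ intersect in a nonempty flat of dimension $d-k$, and no $d+1$ hyperplanes of $L$ have a common point. Suppose that each hyperplane of $L$ is colored with one of $d+1$ colors and that each color appears at least once. A *cell* of the arrangement is a connected component of $\mathbb{R}^d\setminus\bigcup_{H\in L}H$. The *dual* $\hat f$ of a cell $f$ is the simplicial complex whose vertices are the hyperplanes of $L$ bounding $f$ (those supporting a $(d-1)$-dimensional face of $f$), in which a nonempty set of vertices spans a simplex if and only if the intersection of the corresponding hyperplanes appears on the boundary of $f$ (that is, meets it). The *type* of a simplex of $\hat f$ is the multiset of the colors of its vertices, and $n_S(\hat f)$ denotes the number of simplices of type $S$. A type is *good* if it consists of $d$ distinct colors. A bounded cell $f$ is *complete* if $n_S(\hat f)$ is odd for every good type $S$. Then the arrangement has a complete (in particular, bounded) cell. Moreover, every complete cell is $(d+1)$-colored: for each of the $d+1$ colors, it is bounded by at least one hyperplane of that color. -/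

import Mathlib

open Set

/-- `ℝ^d` with its Euclidean structure. -/
abbrev Space (d : ℕ) : Type := EuclideanSpace ℝ (Fin d)

/-- A hyperplane of `ℝ^d`: a nonempty affine subspace of dimension `d - 1`. -/
def IsHyperplane {d : ℕ} (H : AffineSubspace ℝ (Space d)) : Prop :=
  (H : Set (Space d)).Nonempty ∧ Module.finrank ℝ H.direction + 1 = d

/-- The common intersection of the members of `σ`. -/
noncomputable def flat {d : ℕ} (σ : Finset (AffineSubspace ℝ (Space d))) : AffineSubspace ℝ (Space d) :=
  ⨅ H ∈ σ, H

/-- The finite set `L` of hyperplanes induces a simple arrangement: any `k ≤ d` of the hyperplanes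
meet in a (nonempty) flat of dimension `d - k`, and no `d + 1` of them have a common point. -/
structure IsSimpleArrangement {d : ℕ} (L : Finset (AffineSubspace ℝ (Space d))) : Prop where
  isHyperplane : ∀ H ∈ L, IsHyperplane H
  meet : ∀ σ ⊆ L, σ.card ≤ d →
    (flat σ : Set (Space d)).Nonempty ∧ Module.finrank ℝ (flat σ).direction + σ.card = d
  disjoint : ∀ σ ⊆ L, σ.card = d + 1 → (flat σ : Set (Space d)) = ∅

/-- A cell (open `d`-dimensional face) of the arrangement of `L`: a connected component of the
complement of the union of the hyperplanes. -/
def IsCell {d : ℕ} (L : Finset (AffineSubspace ℝ (Space d))) (f : Set (Space d)) : Prop :=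
  ∃ x ∈ (⋃ H ∈ L, (H : Set (Space d)))ᶜ,
    f = connectedComponentIn (⋃ H ∈ L, (H : Set (Space d)))ᶜ x

/-- `H` bounds `f`: it supports a `(d-1)`-dimensional face of `f`, that is, the part of `H` on
the boundary of `f` affinely spans `H`. -/
def IsBounding {d : ℕ} (H : AffineSubspace ℝ (Space d)) (f : Set (Space d)) : Prop :=
  affineSpan ℝ ((H : Set (Space d)) ∩ frontier f) = H

/-- The dual complex of the cell `f` of the arrangement of `L`. Its vertices are the hyperplanes
of `L` bounding `f`, and a nonempty set `σ` of vertices is a simplex if and only if the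
intersection of the hyperplanes in `σ` meets the boundary of `f`. (When the arrangement is simple
and `σ` has `d` elements, that intersection is a point, and the condition says that this point lies
on the boundary of `f`.) -/
noncomputable def dualComplex {d : ℕ} (L : Finset (AffineSubspace ℝ (Space d))) (f : Set (Space d)) :
    PreAbstractSimplicialComplex (AffineSubspace ℝ (Space d)) where
  faces := {σ | σ.Nonempty ∧ (∀ H ∈ σ, H ∈ L ∧ IsBounding H f) ∧
    ((flat σ : Set (Space d)) ∩ frontier f).Nonempty}
  isRelLowerSet_faces := by
    rintro σ ⟨hne, hb, x, hx, hxf⟩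
    refine ⟨hne, fun τ hτσ hτ => ⟨hτ, fun H hH => hb H (hτσ hH), x, ?_, hxf⟩⟩
    exact (biInf_mono (fun H hH => hτσ hH) : flat σ ≤ flat τ) hx

/-- The type of a simplex: the multiset of the colors of its vertices. -/
def colorType {d : ℕ} (c : AffineSubspace ℝ (Space d) → Fin (d + 1))
    (σ : Finset (AffineSubspace ℝ (Space d))) : Multiset (Fin (d + 1)) :=
  σ.val.map c

/-- `n_S`: the number of simplices of type `S` in the dual complex of `f`. -/
noncomputable def typeCount {d : ℕ} (L : Finset (AffineSubspace ℝ (Space d)))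
    (c : AffineSubspace ℝ (Space d) → Fin (d + 1)) (f : Set (Space d))
    (S : Multiset (Fin (d + 1))) : ℕ :=
  {σ | σ ∈ (dualComplex L f).faces ∧ colorType c σ = S}.ncard

/-- A good type: `d` colors without duplicates. -/
def IsGoodType {d : ℕ} (S : Multiset (Fin (d + 1))) : Prop :=
  S.Nodup ∧ S.card = d

/-- A complete cell: a bounded cell such that `n_S` is odd for every good type `S`. -/
def IsCompleteCell {d : ℕ} (L : Finset (AffineSubspace ℝ (Space d)))
    (c : AffineSubspace ℝ (Space d) → Fin (d + 1)) (f : Set (Space d)) : Prop :=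
  IsCell L f ∧ Bornology.IsBounded f ∧
    ∀ S : Multiset (Fin (d + 1)), IsGoodType S → Odd (typeCount L c f S)

/-! The proof tracks bounded cells as positive regions of oriented arrangements and counts their
vertices by color type; for types of size `d` this is the simplex count of the dual
(`typeCount_positiveRegion`).

Two parity facts carry the argument. In a bounded region, a line cut out by `d - 1` hyperplanes
contains no vertex of the region or exactly two. Double counting along these lines shows that all
good types have the same parity (`even_vertexCount_add`), so a single odd good type makes the cell
complete. When a hyperplane `H` splits a region, a vertex off `H` goes to exactly one side, while a
new vertex on `H` belongs to both sides or to neither. Hence the counts on the two sides add up, mod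
2, to the old count, and one side of an odd region is odd (`even_vertexCount_insert`).

One hyperplane of each color gives a simplex with a single vertex of the type omitting color `0`
(`exists_orientation_simplex`). Inserting the remaining hyperplanes one by one, always keeping an
odd side, ends in a complete cell. A complete cell sees color `i` because it has a simplex whose
type omits some other color `j`. -/

/-! ### Equations of hyperplanes and linear algebra at a vertex -/

theorem mem_flat {d : ℕ} {σ : Finset (AffineSubspace ℝ (Space d))} {x : Space d} :
    x ∈ flat σ ↔ ∀ H ∈ σ, x ∈ H := by
  simp [flat, AffineSubspace.mem_iInf_iff]

theorem IsHyperplane.exists_affineMap {d : ℕ} {H : AffineSubspace ℝ (Space d)}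
    (hH : IsHyperplane H) : ∃ g : Space d →ᵃ[ℝ] ℝ, ∀ x, x ∈ H ↔ g x = 0 := by
  obtain ⟨⟨q, hq⟩, hd⟩ := hH
  have hlt : H.direction < ⊤ := by
    rw [lt_top_iff_ne_top]
    intro h
    rw [h, finrank_top, finrank_euclideanSpace_fin] at hd
    omega
  obtain ⟨φ, hφ, hle⟩ := Submodule.exists_le_ker_of_lt_top _ hlt
  have hker : H.direction = LinearMap.ker φ := by
    apply Submodule.eq_of_le_of_finrank_eq hle
    have h := Module.Dual.finrank_ker_add_one_of_ne_zero (f := φ) hφ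
    rw [finrank_euclideanSpace_fin] at h
    omega
  refine ⟨φ.toAffineMap - AffineMap.const ℝ _ (φ q), fun x => ?_⟩
  rw [← AffineSubspace.vsub_right_mem_direction_iff_mem hq, hker]
  simp

/-- The affine functions `g H` are equations of the hyperplanes `H ∈ L`; their signs orient
the hyperplanes. -/
def IsOrientation {d : ℕ} (L : Finset (AffineSubspace ℝ (Space d)))
    (g : AffineSubspace ℝ (Space d) → Space d →ᵃ[ℝ] ℝ) : Prop :=
  ∀ H ∈ L, ∀ x, x ∈ H ↔ g H x = 0

/-- The points on the positive side of every oriented hyperplane. -/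
def positiveRegion {d : ℕ} (L : Finset (AffineSubspace ℝ (Space d)))
    (g : AffineSubspace ℝ (Space d) → Space d →ᵃ[ℝ] ℝ) : Set (Space d) :=
  {x | ∀ H ∈ L, 0 < g H x}

/-- `σ` meets the closed positive region away from all other hyperplanes. -/
def IsRegionFlat {d : ℕ} (L : Finset (AffineSubspace ℝ (Space d)))
    (g : AffineSubspace ℝ (Space d) → Space d →ᵃ[ℝ] ℝ)
    (σ : Finset (AffineSubspace ℝ (Space d))) : Prop :=
  ∃ x ∈ flat σ, ∀ H ∈ L, H ∉ σ → 0 < g H x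

section

variable {d : ℕ} {L : Finset (AffineSubspace ℝ (Space d))}
  {g : AffineSubspace ℝ (Space d) → Space d →ᵃ[ℝ] ℝ}

theorem IsSimpleArrangement.mono (hL : IsSimpleArrangement L)
    {M : Finset (AffineSubspace ℝ (Space d))} (hM : M ⊆ L) : IsSimpleArrangement M :=
  ⟨fun H hH => hL.isHyperplane H (hM hH), fun σ hσ => hL.meet σ (hσ.trans hM),
    fun σ hσ => hL.disjoint σ (hσ.trans hM)⟩

theorem affineMap_add_smul (a : Space d →ᵃ[ℝ] ℝ) (x w : Space d) (t : ℝ) :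
    a (x + t • w) = a x + t * a.linear w := by
  have := a.map_vadd x (t • w)
  simp only [vadd_eq_add, map_smul, smul_eq_mul] at this
  rw [add_comm x, this, add_comm]

theorem affineMap_linear_sub (a : Space d →ᵃ[ℝ] ℝ) (x y : Space d) :
    a.linear (x - y) = a x - a y := by
  simpa using a.linearMap_vsub x y

/-- The flat of `d` hyperplanes is a point, and a common null direction `w` would translate that
point within the flat. -/
theorem eq_zero_of_linear_eq_zero (hL : IsSimpleArrangement L) (hg : IsOrientation L g)
    {σ : Finset (AffineSubspace ℝ (Space d))} (hσ : σ ⊆ L) (hc : σ.card = d) {w : Space d}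
    (hw : ∀ H ∈ σ, (g H).linear w = 0) : w = 0 := by
  obtain ⟨⟨x, hx⟩, hfin⟩ := hL.meet σ hσ hc.le
  have hdir : (flat σ).direction = ⊥ := by
    rw [← Submodule.finrank_eq_zero (R := ℝ)]
    omega
  have hxw : x + w ∈ flat σ := mem_flat.2 fun H hH => by
    rw [hg H (hσ hH)]
    have h := affineMap_add_smul (g H) x w 1
    rw [one_smul] at h
    rw [h, hw H hH, (hg H (hσ hH) x).1 (mem_flat.1 hx H hH)]
    simp
  have h := AffineSubspace.vsub_mem_direction hxw hx
  rw [hdir, Submodule.mem_bot] at h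
  simpa using h

/-- The `d` linear parts are jointly injective on a space of dimension `d`, hence also surjective.
This supplies directions with prescribed slopes at a vertex. -/
theorem exists_linear_eq (hL : IsSimpleArrangement L) (hg : IsOrientation L g)
    {σ : Finset (AffineSubspace ℝ (Space d))} (hσ : σ ⊆ L) (hc : σ.card = d)
    (y : AffineSubspace ℝ (Space d) → ℝ) : ∃ w, ∀ H ∈ σ, (g H).linear w = y H := by
  let Φ : Space d →ₗ[ℝ] (σ → ℝ) := LinearMap.pi fun H => (g H).linear
  have hinj : Function.Injective Φ := by
    rw [← LinearMap.ker_eq_bot, LinearMap.ker_eq_bot']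
    intro w hw
    exact eq_zero_of_linear_eq_zero hL hg hσ hc fun H hH => congrFun hw ⟨H, hH⟩
  have hsurj : Function.Surjective Φ :=
    (LinearMap.injective_iff_surjective_of_finrank_eq_finrank (by simp [hc])).1 hinj
  obtain ⟨w, hw⟩ := hsurj fun H => y H
  exact ⟨w, fun H hH => congrFun hw ⟨H, hH⟩⟩

theorem apply_ne_zero_of_notMem (hL : IsSimpleArrangement L) (hg : IsOrientation L g)
    {σ : Finset (AffineSubspace ℝ (Space d))} (hσ : σ ⊆ L) (hc : σ.card = d) {x : Space d}
    (hx : x ∈ flat σ) {H : AffineSubspace ℝ (Space d)} (hH : H ∈ L) (hHσ : H ∉ σ) :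
    g H x ≠ 0 := by
  classical
  intro h
  have hd := hL.disjoint (insert H σ) (Finset.insert_subset hH hσ)
    (by rw [Finset.card_insert_of_notMem hHσ, hc])
  have hx' : x ∈ (flat (insert H σ) : Set (Space d)) := mem_flat.2 fun K hK => by
    rcases Finset.mem_insert.1 hK with rfl | hK
    · exact (hg _ hH x).2 h
    · exact mem_flat.1 hx K hK
  rw [hd] at hx'
  exact hx'

/-! ### Topology of the positive region -/

theorem continuous_affineMap (a : Space d →ᵃ[ℝ] ℝ) : Continuous a :=
  a.continuous_of_finiteDimensional

theorem isOpen_positiveRegion (L : Finset (AffineSubspace ℝ (Space d)))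
    (g : AffineSubspace ℝ (Space d) → Space d →ᵃ[ℝ] ℝ) : IsOpen (positiveRegion L g) := by
  have : positiveRegion L g = ⋂ H ∈ L, {x | 0 < g H x} := by
    ext x; simp [positiveRegion]
  rw [this]
  exact isOpen_biInter_finset fun H _ => isOpen_lt continuous_const (continuous_affineMap _)

theorem convex_positiveRegion (L : Finset (AffineSubspace ℝ (Space d)))
    (g : AffineSubspace ℝ (Space d) → Space d →ᵃ[ℝ] ℝ) : Convex ℝ (positiveRegion L g) := by
  have : positiveRegion L g = ⋂ H ∈ L, (g H) ⁻¹' Ioi 0 := by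
    ext x; simp [positiveRegion]
  rw [this]
  exact convex_iInter₂ fun H _ => (convex_Ioi (0 : ℝ)).affine_preimage (g H)

theorem nonneg_of_mem_closure {x : Space d} (hx : x ∈ closure (positiveRegion L g))
    {H : AffineSubspace ℝ (Space d)} (hH : H ∈ L) : 0 ≤ g H x :=
  closure_minimal (fun _ hy => (hy H hH).le)
    (isClosed_le continuous_const (continuous_affineMap (g H))) hx

open Filter Topology in
theorem eventually_pos_add_smul (a : Space d →ᵃ[ℝ] ℝ) {z : Space d} (hz : 0 < a z)
    (w : Space d) : ∀ᶠ t : ℝ in 𝓝[>] 0, 0 < a (z + t • w) := by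
  have hcont : Continuous fun t : ℝ => a (z + t • w) :=
    (continuous_affineMap a).comp (by fun_prop)
  have h : ∀ᶠ t : ℝ in 𝓝 0, 0 < a (z + t • w) :=
    hcont.continuousAt.eventually_const_lt (by simpa using hz)
  exact h.filter_mono nhdsWithin_le_nhds

open Filter Topology in
-- The direction `w` points strictly inwards across every member of `σ`, so `z + t • w` lies in the
-- region for all small `t > 0`.
theorem mem_closure_positiveRegion {σ : Finset (AffineSubspace ℝ (Space d))} {w : Space d}
    (hw : ∀ H ∈ σ, (g H).linear w = 1) {z : Space d} (h0 : ∀ H ∈ σ, 0 ≤ g H z)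
    (h1 : ∀ H ∈ L, H ∉ σ → 0 < g H z) : z ∈ closure (positiveRegion L g) := by
  have hev : ∀ᶠ t : ℝ in 𝓝[>] 0, z + t • w ∈ positiveRegion L g := by
    refine (Filter.eventually_all_finset L).2 fun H hH => ?_
    by_cases hHσ : H ∈ σ
    · filter_upwards [self_mem_nhdsWithin] with t ht
      rw [affineMap_add_smul, hw H hHσ, mul_one]
      exact add_pos_of_nonneg_of_pos (h0 H hHσ) ht
    · exact eventually_pos_add_smul _ (h1 H hH hHσ) w
  have hcont : Continuous fun t : ℝ => z + t • w := by fun_prop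
  have htend : Tendsto (fun t : ℝ => z + t • w) (𝓝[>] 0) (𝓝 z) := by
    have h := hcont.tendsto 0
    simp only [zero_smul, add_zero] at h
    exact h.mono_left nhdsWithin_le_nhds
  exact mem_closure_of_tendsto htend hev

theorem mem_frontier_positiveRegion {x : Space d} (hx : x ∈ closure (positiveRegion L g))
    {H : AffineSubspace ℝ (Space d)} (hH : H ∈ L) (h0 : g H x = 0) :
    x ∈ frontier (positiveRegion L g) := by
  rw [(isOpen_positiveRegion L g).frontier_eq]
  exact ⟨hx, fun h => (h H hH).ne' h0⟩

open Filter Topology in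
-- Near its vertex the region is a simplicial cone, so its facet on `H` contains small segments in
-- all weakly inward directions of `H`. Differences of such directions fill the direction of `H`.
theorem isBounding_positiveRegion (hL : IsSimpleArrangement L) (hg : IsOrientation L g)
    {σ : Finset (AffineSubspace ℝ (Space d))} (hσ : σ ⊆ L) (hc : σ.card = d)
    (hv : IsRegionFlat L g σ) {H : AffineSubspace ℝ (Space d)} (hH : H ∈ σ) :
    IsBounding H (positiveRegion L g) := by
  classical
  obtain ⟨x, hx, hpos⟩ := hv
  have hx0 : ∀ K ∈ σ, g K x = 0 := fun K hK => (hg K (hσ hK) x).1 (mem_flat.1 hx K hK)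
  obtain ⟨w, hw⟩ := exists_linear_eq hL hg hσ hc fun _ => 1
  -- `e` is parallel to `H` and points strictly inwards across the other members of `σ`.
  obtain ⟨e, he⟩ := exists_linear_eq hL hg hσ hc fun K => if K = H then 0 else 1
  -- Every direction of `H` pointing weakly inwards at `x` stays in the boundary for a while.
  have key : ∀ v : Space d, (g H).linear v = 0 → (∀ K ∈ σ, 0 ≤ (g K).linear v) →
      ∀ᶠ t : ℝ in 𝓝[>] 0, x + t • v ∈ (H : Set (Space d)) ∩ frontier (positiveRegion L g) := by
    intro v hv0 hvK
    have hev : ∀ᶠ t : ℝ in 𝓝[>] 0, ∀ K ∈ L, K ∉ σ → 0 < g K (x + t • v) := by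
      refine (Filter.eventually_all_finset L).2 fun K hK => ?_
      by_cases hKσ : K ∈ σ
      · exact Eventually.of_forall fun _ h => absurd hKσ h
      · filter_upwards [eventually_pos_add_smul _ (hpos K hK hKσ) v] with t ht _ using ht
    filter_upwards [hev, self_mem_nhdsWithin] with t ht ht0
    have hzero : g H (x + t • v) = 0 := by
      rw [affineMap_add_smul, hx0 H hH, hv0]; simp
    refine ⟨(hg H (hσ hH) _).2 hzero, mem_frontier_positiveRegion ?_ (hσ hH) hzero⟩
    refine mem_closure_positiveRegion hw (fun K hK => ?_) ht
    rw [affineMap_add_smul, hx0 K hK, zero_add]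
    exact mul_nonneg (le_of_lt ht0) (hvK K hK)
  apply le_antisymm (affineSpan_le.2 inter_subset_left)
  intro y hy
  have hlin : ∀ K ∈ σ, (g K).linear (y - x) = g K y := fun K hK => by
    rw [affineMap_linear_sub, hx0 K hK, sub_zero]
  have hy0 : g H y = 0 := (hg H (hσ hH) y).1 hy
  -- `M` is large enough that `(y - x) + M • e` points weakly inwards; then `y - x` is the
  -- difference of the two inward directions `(y - x) + M • e` and `M • e`.
  obtain ⟨M, hM⟩ := (σ.finite_toSet.image fun K => |g K y|).bddAbove
  have hMK : ∀ K ∈ σ, |g K y| ≤ M := fun K hK => hM ⟨K, hK, rfl⟩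
  have hM0 : 0 ≤ M := (abs_nonneg _).trans (hMK H hH)
  have h1 := key (M • e) (by simp [he H hH]) fun K hK => by
    rw [map_smul, he K hK]; split_ifs <;> simp [hM0]
  have h2 := key ((y - x) + M • e) (by simp only [map_add, map_smul, he H hH, hlin H hH, hy0]; simp)
    fun K hK => by
      rw [map_add, map_smul, he K hK, hlin K hK]
      split_ifs with h
      · subst h; simp [hy0]
      · have := neg_abs_le (g K y)
        have := hMK K hK
        simp only [smul_eq_mul, mul_one]
        linarith
  have h3 := key 0 (by simp) (by simp)
  obtain ⟨t, ⟨⟨h1, h2⟩, h3⟩, ht : 0 < t⟩ := (((h1.and h2).and h3).and self_mem_nhdsWithin).exists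
  have hxs := subset_affineSpan ℝ _ h3
  simp only [smul_zero, add_zero] at hxs
  have hdir := AffineSubspace.vsub_mem_direction (subset_affineSpan ℝ _ h2) (subset_affineSpan ℝ _ h1)
  have hdir' := Submodule.smul_mem _ t⁻¹ hdir
  have : y = (t⁻¹ • ((x + t • (y - x + M • e)) -ᵥ (x + t • M • e))) +ᵥ x := by
    simp only [vsub_eq_sub, vadd_eq_add, smul_add, add_sub_add_left_eq_sub, add_sub_cancel_right]
    rw [smul_smul, inv_mul_cancel₀ ht.ne']
    simp
  rw [this]
  exact AffineSubspace.vadd_mem_of_mem_direction hdir' hxs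

theorem IsRegionFlat.exists_mem_closure (hL : IsSimpleArrangement L) (hg : IsOrientation L g)
    {σ : Finset (AffineSubspace ℝ (Space d))} (hσ : σ ⊆ L) (hc : σ.card = d)
    (hv : IsRegionFlat L g σ) : ∃ x ∈ flat σ, x ∈ closure (positiveRegion L g) := by
  obtain ⟨x, hx, hpos⟩ := hv
  obtain ⟨w, hw⟩ := exists_linear_eq hL hg hσ hc fun _ => 1
  exact ⟨x, hx, mem_closure_positiveRegion hw
    (fun K hK => ((hg K (hσ hK) x).1 (mem_flat.1 hx K hK)).ge) hpos⟩

/-- The region is convex, hence connected. Conversely, a point of the component on the wrong side of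
some `H` would force a zero of `g H` in the component, by the intermediate value theorem. -/
theorem isCell_positiveRegion (hg : IsOrientation L g) (hne : (positiveRegion L g).Nonempty) :
    IsCell L (positiveRegion L g) := by
  obtain ⟨x, hx⟩ := hne
  have hsub : positiveRegion L g ⊆ (⋃ H ∈ L, (H : Set (Space d)))ᶜ := by
    intro y hy hyU
    simp only [mem_iUnion] at hyU
    obtain ⟨H, hH, hyH⟩ := hyU
    exact (hy H hH).ne' ((hg H hH y).1 hyH)
  refine ⟨x, hsub hx, Subset.antisymm
    ((convex_positiveRegion L g).isPreconnected.subset_connectedComponentIn hx hsub) ?_⟩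
  intro y hy H hH
  by_contra! hneg
  obtain ⟨z, hz, hz0⟩ := isPreconnected_connectedComponentIn.intermediate_value hy
    (mem_connectedComponentIn (hsub hx)) (continuous_affineMap (g H)).continuousOn
    ⟨hneg, (hx H hH).le⟩
  exact connectedComponentIn_subset _ _ hz (mem_biUnion hH ((hg H hH z).2 hz0))

/-! ### Vertex counts and simplices of the dual -/

open Classical in
/-- The number of vertices of the positive region whose hyperplanes have color type `S`. -/
noncomputable def vertexCount (L : Finset (AffineSubspace ℝ (Space d)))
    (g : AffineSubspace ℝ (Space d) → Space d →ᵃ[ℝ] ℝ)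
    (c : AffineSubspace ℝ (Space d) → Fin (d + 1)) (S : Multiset (Fin (d + 1))) : ℕ :=
  ((L.powersetCard d).filter fun σ => IsRegionFlat L g σ ∧ colorType c σ = S).card

/-- A simplex of type `S` has `d` elements, so its flat is a point. On the boundary the other
equations are nonnegative there, and simplicity makes them positive. The converse needs every
hyperplane through a vertex to bound the region. -/
theorem typeCount_positiveRegion (hd : 1 ≤ d) (hL : IsSimpleArrangement L)
    (hg : IsOrientation L g) (c : AffineSubspace ℝ (Space d) → Fin (d + 1))
    {S : Multiset (Fin (d + 1))} (hS : S.card = d) :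
    typeCount L c (positiveRegion L g) S = vertexCount L g c S := by
  classical
  rw [typeCount, vertexCount, ← Set.ncard_coe_finset]
  congr 1
  ext σ
  simp only [Set.mem_ofPred_eq, Finset.coe_filter, Finset.mem_powersetCard]
  constructor
  · rintro ⟨⟨hne, hb, x, hx, hxf⟩, hcol⟩
    have hσ : σ ⊆ L := fun H hH => (hb H hH).1
    have hc : σ.card = d := by
      have h : (colorType c σ).card = σ.card := Multiset.card_map c σ.val
      rw [← h, hcol, hS]
    refine ⟨⟨hσ, hc⟩, ⟨x, hx, fun H hH hHσ => ?_⟩, hcol⟩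
    exact lt_of_le_of_ne (nonneg_of_mem_closure (frontier_subset_closure hxf) hH)
      (apply_ne_zero_of_notMem hL hg hσ hc hx hH hHσ).symm
  · rintro ⟨⟨hσ, hc⟩, hv, hcol⟩
    have hne : σ.Nonempty := Finset.card_pos.1 (by omega)
    obtain ⟨x, hx, hxc⟩ := hv.exists_mem_closure hL hg hσ hc
    obtain ⟨H, hH⟩ := hne
    exact ⟨⟨⟨H, hH⟩, fun K hK => ⟨hσ hK, isBounding_positiveRegion hL hg hσ hc hv hK⟩, x, hx,
      mem_frontier_positiveRegion hxc (hσ hH) ((hg H (hσ hH) x).1 (mem_flat.1 hx H hH))⟩, hcol⟩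

end

/-! ### Parity of vertices along lines -/

/-- The functions `b i * (t - r i)` are all positive exactly between `r u`, the largest root with
positive slope, and `r v`, the smallest with negative slope. The filter picks the endpoints of this
interval: two if it is nonempty, none otherwise. -/
theorem even_card_filter_roots {ι : Type*} [DecidableEq ι] (A : Finset ι) (b r : ι → ℝ)
    (hb : ∀ i ∈ A, b i ≠ 0) (hr : ∀ i ∈ A, ∀ j ∈ A, r i = r j → i = j)
    (hpos : ∃ i ∈ A, 0 < b i) (hneg : ∃ i ∈ A, b i < 0) :
    Even (A.filter fun i => ∀ j ∈ A, j ≠ i → 0 < b j * (r i - r j)).card := by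
  obtain ⟨i₀, hi₀, hi₀'⟩ := hpos
  obtain ⟨j₀, hj₀, hj₀'⟩ := hneg
  obtain ⟨u, hu, humax⟩ := (A.filter fun i => 0 < b i).exists_max_image r ⟨i₀, by simp [*]⟩
  obtain ⟨v, hv, hvmin⟩ := (A.filter fun i => b i < 0).exists_min_image r ⟨j₀, by simp [*]⟩
  simp only [Finset.mem_filter, and_imp] at hu hv humax hvmin
  have huv : u ≠ v := fun h => by subst h; linarith [hu.2, hv.2]
  by_cases hlt : r u < r v
  · have : (A.filter fun i => ∀ j ∈ A, j ≠ i → 0 < b j * (r i - r j)) = {u, v} := by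
      ext i
      simp only [Finset.mem_filter, Finset.mem_insert, Finset.mem_singleton]
      constructor
      · rintro ⟨hi, hij⟩
        by_contra! hne
        rcases lt_or_gt_of_ne (hb i hi) with h | h
        · have h1 := hij v hv.1 hne.2.symm
          nlinarith [hvmin i hi h, hv.2]
        · have h1 := hij u hu.1 hne.1.symm
          nlinarith [humax i hi h, hu.2]
      · rintro (rfl | rfl)
        · refine ⟨hu.1, fun j hj hji => ?_⟩
          have hne : r j ≠ r i := fun h => hji (hr j hj i hu.1 h)
          rcases lt_or_gt_of_ne (hb j hj) with h | h
          · exact mul_pos_of_neg_of_neg h (by linarith [hvmin j hj h])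
          · exact mul_pos h (sub_pos.2 (lt_of_le_of_ne (humax j hj h) hne))
        · refine ⟨hv.1, fun j hj hji => ?_⟩
          have hne : r j ≠ r i := fun h => hji (hr j hj i hv.1 h)
          rcases lt_or_gt_of_ne (hb j hj) with h | h
          · exact mul_pos_of_neg_of_neg h (sub_neg.2 (lt_of_le_of_ne (hvmin j hj h) hne.symm))
          · exact mul_pos h (by linarith [humax j hj h])
    rw [this, Finset.card_pair huv]
    exact even_two
  · have : (A.filter fun i => ∀ j ∈ A, j ≠ i → 0 < b j * (r i - r j)) = ∅ := by
      refine Finset.filter_eq_empty_iff.2 fun i hi hij => hlt ?_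
      have hu' : u ≠ i → r u < r i := fun h => by
        have := (mul_pos_iff_of_pos_left hu.2).1 (hij u hu.1 h); linarith
      have hv' : v ≠ i → r i < r v := fun h => by
        nlinarith [hij v hv.1 h, hv.2]
      by_cases h1 : u = i
      · subst h1; exact hv' huv.symm
      · by_cases h2 : v = i
        · subst h2; exact hu' h1
        · exact (hu' h1).trans (hv' h2)
    rw [this]
    simp

/-- If every `τ` of the size of `T` has an even number of one-point extensions in `V`, then the
numbers of members of `V` of the two types that extend `T` by a new color have the same parity. -/
theorem even_card_add_card_of_even_extensions {α κ : Type*} [DecidableEq α] [DecidableEq κ]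
    (L : Finset α) (V : Finset (Finset α)) (c : α → κ) (T : Multiset κ) {i j : κ}
    (hV : ∀ σ ∈ V, σ ⊆ L) (hT : T.Nodup) (hij : i ≠ j) (hi : i ∉ T) (hj : j ∉ T)
    (hall : ∀ k, k = i ∨ k = j ∨ k ∈ T)
    (hext : ∀ τ ⊆ L, τ.card = T.card → Even ((L \ τ).filter fun H => insert H τ ∈ V).card) :
    Even ((V.filter fun σ => σ.val.map c = i ::ₘ T).card +
      (V.filter fun σ => σ.val.map c = j ::ₘ T).card) := by
  -- The filter counts the `H` in `σ` whose removal leaves type `T`. If `σ` has type `k ::ₘ T`,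
  -- there is one such `H` for `k = i` or `k = j`, and there are two for `k ∈ T`.
  have hlocal : ∀ σ ∈ V, Even ((σ.filter fun H => σ.val.map c = c H ::ₘ T).card +
      ((if σ.val.map c = i ::ₘ T then 1 else 0) + if σ.val.map c = j ::ₘ T then 1 else 0)) := by
    intro σ _
    by_cases h : ∃ k, σ.val.map c = k ::ₘ T
    · obtain ⟨k, hk⟩ := h
      have hcount : (σ.filter fun H => σ.val.map c = c H ::ₘ T).card = T.count k + 1 := by
        rw [← Multiset.count_cons_self, ← hk, Multiset.count_map, Finset.card_def,
          Finset.filter_val]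
        congr 1
        refine Multiset.filter_congr fun H _ => ?_
        rw [hk, Multiset.cons_inj_left]
      rw [hcount]
      simp only [hk, Multiset.cons_inj_left]
      rcases hall k with rfl | rfl | hkT
      · simp [hij, Multiset.count_eq_zero_of_notMem hi]
      · simp [hij.symm, Multiset.count_eq_zero_of_notMem hj]
      · have h1 : k ≠ i := fun h => hi (h ▸ hkT)
        have h2 : k ≠ j := fun h => hj (h ▸ hkT)
        simp [h1, h2, Multiset.count_eq_one_of_mem hT hkT]
    · push Not at h
      simp [h]
  -- Pairs `(σ, H)` with `H ∈ σ` correspond to pairs `(τ, H)` with `τ = σ.erase H` of type `T`.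
  have hpairs : ∑ σ ∈ V, (σ.filter fun H => σ.val.map c = c H ::ₘ T).card =
      ∑ τ ∈ (L.powersetCard T.card).filter fun τ => τ.val.map c = T,
        ((L \ τ).filter fun H => insert H τ ∈ V).card := by
    rw [← Finset.card_sigma, ← Finset.card_sigma]
    refine Finset.card_nbij' (fun p => ⟨p.1.erase p.2, p.2⟩) (fun p => ⟨insert p.2 p.1, p.2⟩)
      ?_ ?_ ?_ ?_
    · rintro ⟨σ, H⟩ hp
      simp only [Finset.coe_sigma, Set.mem_sigma_iff, Finset.mem_coe, Finset.mem_filter] at hp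
      obtain ⟨hσ, hH, hcol⟩ := hp
      have htype : (σ.erase H).val.map c = T := by
        rw [← Finset.insert_erase hH, Finset.insert_val_of_notMem (Finset.notMem_erase H σ),
          Multiset.map_cons] at hcol
        simpa using hcol
      simp only [Finset.coe_sigma, Set.mem_sigma_iff, Finset.mem_coe, Finset.mem_filter,
        Finset.mem_powersetCard, Finset.mem_sdiff, Finset.insert_erase hH]
      refine ⟨⟨⟨(Finset.erase_subset _ _).trans (hV σ hσ), ?_⟩, htype⟩,
        ⟨hV σ hσ hH, Finset.notMem_erase H σ⟩, hσ⟩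
      rw [← htype, Multiset.card_map, Finset.card_def]
    · rintro ⟨τ, H⟩ hp
      simp only [Finset.coe_sigma, Set.mem_sigma_iff, Finset.mem_coe, Finset.mem_filter,
        Finset.mem_powersetCard, Finset.mem_sdiff] at hp
      obtain ⟨⟨-, hcol⟩, ⟨-, hHτ⟩, hins⟩ := hp
      simp only [Finset.coe_sigma, Set.mem_sigma_iff, Finset.mem_coe, Finset.mem_filter]
      refine ⟨hins, Finset.mem_insert_self _ _, ?_⟩
      rw [Finset.insert_val_of_notMem hHτ, Multiset.map_cons, hcol]
    · rintro ⟨σ, H⟩ hp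
      simp only [Finset.coe_sigma, Set.mem_sigma_iff, Finset.mem_coe, Finset.mem_filter] at hp
      simp [Finset.insert_erase hp.2.1]
    · rintro ⟨τ, H⟩ hp
      simp only [Finset.coe_sigma, Set.mem_sigma_iff, Finset.mem_coe, Finset.mem_filter,
        Finset.mem_sdiff] at hp
      simp [Finset.erase_insert hp.2.1.2]
  have heven : Even (∑ σ ∈ V, (σ.filter fun H => σ.val.map c = c H ::ₘ T).card) := by
    rw [hpairs]
    refine Finset.even_sum _ fun τ hτ => ?_
    rw [Finset.mem_filter, Finset.mem_powersetCard] at hτ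
    exact hext τ hτ.1.1 hτ.1.2
  have htotal := Finset.even_sum _ hlocal
  rw [Finset.sum_add_distrib, Nat.even_add] at htotal
  have := htotal.1 heven
  rwa [Finset.sum_add_distrib, ← Finset.card_filter, ← Finset.card_filter] at this

section

variable {d : ℕ} {L : Finset (AffineSubspace ℝ (Space d))}
  {g : AffineSubspace ℝ (Space d) → Space d →ᵃ[ℝ] ℝ}

open Filter in
-- Far along the ray `p + t • v` the members of `τ` still vanish while all others have become
-- positive, so the closure of the region contains points arbitrarily far away.
theorem not_isBounded_of_ray {τ : Finset (AffineSubspace ℝ (Space d))} {w p v : Space d}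
    (hw : ∀ H ∈ τ, (g H).linear w = 1) (hp : ∀ H ∈ τ, g H p = 0) (hv : v ≠ 0)
    (hvτ : ∀ H ∈ τ, (g H).linear v = 0) (hvL : ∀ H ∈ L, H ∉ τ → 0 < (g H).linear v) :
    ¬ Bornology.IsBounded (positiveRegion L g) := by
  intro hbd
  obtain ⟨R, hR⟩ := hbd.closure.subset_closedBall p
  have hev : ∀ᶠ t : ℝ in atTop, ∀ H ∈ L, H ∉ τ → 0 < g H (p + t • v) := by
    refine (Filter.eventually_all_finset L).2 fun H hH => ?_
    by_cases hHτ : H ∈ τ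
    · exact Eventually.of_forall fun _ h => absurd hHτ h
    · filter_upwards [eventually_gt_atTop (-(g H p) / (g H).linear v)] with t ht _
      rw [affineMap_add_smul]
      rw [div_lt_iff₀ (hvL H hH hHτ)] at ht
      linarith
  obtain ⟨t, ⟨ht, htR⟩, ht0⟩ :=
    ((hev.and (eventually_gt_atTop (R / ‖v‖))).and (eventually_ge_atTop 0)).exists
  have hmem := hR (mem_closure_positiveRegion hw (z := p + t • v) (fun H hH => by
    rw [affineMap_add_smul, hp H hH, hvτ H hH]; simp) ht)
  rw [Metric.mem_closedBall, dist_eq_norm, add_sub_cancel_left, norm_smul, Real.norm_eq_abs,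
    abs_of_nonneg ht0] at hmem
  rw [div_lt_iff₀ (norm_pos_iff.2 hv)] at htR
  linarith

open Classical in
-- On the line `p + t • v` cut out by `τ`, each remaining `g H` is `b H * (t - r H)`. Simplicity
-- makes the slopes nonzero and the roots distinct, and boundedness forces both signs of slope to
-- occur.
theorem even_card_vertices_on_line (hL : IsSimpleArrangement L) (hg : IsOrientation L g)
    (hbd : Bornology.IsBounded (positiveRegion L g))
    {τ : Finset (AffineSubspace ℝ (Space d))} (hτ : τ ⊆ L) (hc : τ.card + 1 = d) :
    Even ((L \ τ).filter fun H => IsRegionFlat L g (insert H τ)).card := by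
  have hins : ∀ H ∈ L \ τ, insert H τ ⊆ L ∧ (insert H τ).card = d := fun H hH => by
    rw [Finset.mem_sdiff] at hH
    exact ⟨Finset.insert_subset hH.1 hτ, by rw [Finset.card_insert_of_notMem hH.2, hc]⟩
  rcases (L \ τ).eq_empty_or_nonempty with hemp | ⟨H₀, hH₀⟩
  · simp [hemp]
  -- `τ` has only `d - 1` members; `H₀` completes it to a `d`-set so that an inward direction
  -- exists.
  obtain ⟨w, hw⟩ := exists_linear_eq hL hg (hins H₀ hH₀).1 (hins H₀ hH₀).2 fun _ => 1
  replace hw : ∀ H ∈ τ, (g H).linear w = 1 := fun H hH => hw H (Finset.mem_insert_of_mem hH)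
  obtain ⟨⟨p, hp⟩, hfin⟩ := hL.meet τ hτ (by omega)
  obtain ⟨⟨v, hvdir⟩, hv0, hspan⟩ :=
    finrank_eq_one_iff'.1 (show Module.finrank ℝ (flat τ).direction = 1 by omega)
  replace hv0 : v ≠ 0 := fun h => hv0 (Subtype.ext h)
  have hflat : ∀ x, x ∈ flat τ ↔ ∃ t : ℝ, x = p + t • v := fun x => by
    constructor
    · intro hx
      obtain ⟨t, ht⟩ := hspan ⟨x -ᵥ p, AffineSubspace.vsub_mem_direction hx hp⟩
      have ht : t • v = x - p := congrArg Subtype.val ht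
      exact ⟨t, by rw [ht]; abel⟩
    · rintro ⟨t, rfl⟩
      have := AffineSubspace.vadd_mem_of_mem_direction
        (Submodule.smul_mem _ t hvdir) hp
      rwa [vadd_eq_add, add_comm] at this
  have hpτ : ∀ H ∈ τ, g H p = 0 := fun H hH => (hg H (hτ hH) p).1 (mem_flat.1 hp H hH)
  have hvτ : ∀ H ∈ τ, (g H).linear v = 0 := fun H hH => by
    have h1 := mem_flat.1 ((hflat _).2 ⟨1, rfl⟩) H hH
    rw [hg H (hτ hH), affineMap_add_smul, hpτ H hH] at h1
    simpa using h1
  set b : AffineSubspace ℝ (Space d) → ℝ := fun H => (g H).linear v with hb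
  set r : AffineSubspace ℝ (Space d) → ℝ := fun H => -(g H p) / b H with hr
  have hbne : ∀ H ∈ L \ τ, b H ≠ 0 := fun H hH h => hv0 <|
    eq_zero_of_linear_eq_zero hL hg (hins H hH).1 (hins H hH).2 fun K hK => by
      rcases Finset.mem_insert.1 hK with rfl | hK
      exacts [h, hvτ K hK]
  have hval : ∀ H ∈ L \ τ, ∀ t : ℝ, g H (p + t • v) = b H * (t - r H) := fun H hH t => by
    rw [affineMap_add_smul, mul_sub, hr, mul_div_cancel₀ _ (hbne H hH)]
    ring
  have hvert : ∀ H ∈ L \ τ, ∀ x, x ∈ flat (insert H τ) ↔ x = p + r H • v := fun H hH x => by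
    have hHL := (Finset.mem_sdiff.1 hH).1
    have hsplit : x ∈ flat (insert H τ) ↔ x ∈ H ∧ x ∈ flat τ := by
      simp only [mem_flat, Finset.forall_mem_insert]
    rw [hsplit, hg H hHL, hflat]
    constructor
    · rintro ⟨h0, t, rfl⟩
      rw [hval H hH, mul_eq_zero, or_iff_right (hbne H hH), sub_eq_zero] at h0
      rw [h0]
    · rintro rfl
      exact ⟨by rw [hval H hH, sub_self, mul_zero], _, rfl⟩
  have hrinj : ∀ H ∈ L \ τ, ∀ K ∈ L \ τ, r H = r K → H = K := fun H hH K hK h => by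
    by_contra hne
    refine apply_ne_zero_of_notMem hL hg (hins K hK).1 (hins K hK).2 ((hvert K hK _).2 rfl)
      (Finset.mem_sdiff.1 hH).1 ?_ (by rw [hval H hH, h, sub_self, mul_zero])
    rw [Finset.mem_insert, not_or]
    exact ⟨hne, (Finset.mem_sdiff.1 hH).2⟩
  have hpos : ∃ H ∈ L \ τ, 0 < b H := by
    by_contra! hcon
    refine not_isBounded_of_ray (L := L) (v := -v) hw hpτ (neg_ne_zero.2 hv0)
      (fun H hH => by rw [map_neg, hvτ H hH, neg_zero]) (fun H hH hHτ => ?_) hbd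
    have hm := Finset.mem_sdiff.2 ⟨hH, hHτ⟩
    rw [map_neg, neg_pos]
    exact lt_of_le_of_ne (hcon H hm) (hbne H hm)
  have hneg : ∃ H ∈ L \ τ, b H < 0 := by
    by_contra! hcon
    refine not_isBounded_of_ray (L := L) (v := v) hw hpτ hv0 hvτ (fun H hH hHτ => ?_) hbd
    have hm := Finset.mem_sdiff.2 ⟨hH, hHτ⟩
    exact lt_of_le_of_ne (hcon H hm) (hbne H hm).symm
  have := even_card_filter_roots (L \ τ) b r hbne hrinj hpos hneg
  convert this using 2
  refine Finset.filter_congr fun H hH => ?_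
  constructor
  · rintro ⟨x, hx, hxpos⟩ K hK hKH
    rw [hvert H hH] at hx
    subst hx
    rw [← hval K hK]
    rw [Finset.mem_sdiff] at hK
    exact hxpos K hK.1 (by rw [Finset.mem_insert, not_or]; exact ⟨hKH, hK.2⟩)
  · intro h
    refine ⟨_, (hvert H hH _).2 rfl, fun K hKL hK => ?_⟩
    rw [Finset.mem_insert, not_or] at hK
    have hm := Finset.mem_sdiff.2 ⟨hKL, hK.2⟩
    rw [hval K hm]
    exact h K hm hK.1

/-- The two types share the `d - 1` colors of `T`, and the one-point extensions of a `τ` of type `T`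
are the region's vertices on the line of `τ`. -/
theorem even_vertexCount_add (hL : IsSimpleArrangement L)
    (hg : IsOrientation L g) (hbd : Bornology.IsBounded (positiveRegion L g))
    (c : AffineSubspace ℝ (Space d) → Fin (d + 1)) {i j : Fin (d + 1)} (hij : i ≠ j) :
    Even (vertexCount L g c (Finset.univ.erase i).val +
      vertexCount L g c (Finset.univ.erase j).val) := by
  classical
  set T : Multiset (Fin (d + 1)) := ((Finset.univ.erase i).erase j).val with hT
  have hi : (Finset.univ.erase i).val = j ::ₘ T := by
    rw [hT, ← Finset.insert_val_of_notMem (Finset.notMem_erase _ _),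
      Finset.insert_erase (by simp [hij.symm])]
  have hj : (Finset.univ.erase j).val = i ::ₘ T := by
    rw [hT, Finset.erase_right_comm, ← Finset.insert_val_of_notMem (Finset.notMem_erase _ _),
      Finset.insert_erase (by simp [hij])]
  have hcard : T.card + 1 = d := by
    rw [← Multiset.card_cons j, ← hi, ← Finset.card_def, Finset.card_erase_of_mem (by simp)]
    simp
  have := even_card_add_card_of_even_extensions L
    ((L.powersetCard d).filter fun σ => IsRegionFlat L g σ) c T (i := j) (j := i)
    (fun σ hσ => (Finset.mem_powersetCard.1 (Finset.mem_filter.1 hσ).1).1) (Finset.nodup _)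
    hij.symm (by rw [hT, Finset.mem_val]; simp) (by rw [hT, Finset.mem_val]; simp) (fun k => by
      simp only [hT, Finset.mem_val, Finset.mem_erase, Finset.mem_univ]; tauto)
    (fun τ hτ hτc => by
      convert even_card_vertices_on_line hL hg hbd hτ (by omega) using 2
      refine Finset.filter_congr fun H hH => ?_
      rw [Finset.mem_sdiff] at hH
      rw [Finset.mem_filter, Finset.mem_powersetCard, and_iff_right]
      exact ⟨Finset.insert_subset hH.1 hτ, by rw [Finset.card_insert_of_notMem hH.2]; omega⟩)
  rw [Finset.filter_filter, Finset.filter_filter] at this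
  rw [vertexCount, vertexCount, hi, hj]
  exact this

open Classical in
-- Each `σ` contributes an even amount. If `H ∈ σ`, the sign of `g H` is irrelevant, so `σ` counts
-- equally on both sides and not in `L`. If `H ∉ σ`, a vertex of the old region counts once in `L`
-- and once on the side of `H` containing it.
theorem even_vertexCount_insert (c : AffineSubspace ℝ (Space d) → Fin (d + 1))
    (S : Multiset (Fin (d + 1))) {H : AffineSubspace ℝ (Space d)} (hH : H ∉ L)
    (hL : IsSimpleArrangement (insert H L)) (hg : IsOrientation (insert H L) g) :
    Even (vertexCount (insert H L) g c S +
      vertexCount (insert H L) (Function.update g H (-g H)) c S + vertexCount L g c S) := by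
  have hold : vertexCount L g c S = (((insert H L).powersetCard d).filter fun σ =>
      H ∉ σ ∧ IsRegionFlat L g σ ∧ colorType c σ = S).card := by
    rw [vertexCount]
    congr 1
    ext σ
    simp only [Finset.mem_filter, Finset.mem_powersetCard]
    constructor
    · rintro ⟨⟨h1, h2⟩, h3⟩
      exact ⟨⟨h1.trans (Finset.subset_insert _ _), h2⟩, fun h => hH (h1 h), h3⟩
    · rintro ⟨⟨h1, h2⟩, h3, h4⟩
      exact ⟨⟨(Finset.subset_insert_iff_of_notMem h3).1 h1, h2⟩, h4⟩
  have hupd : ∀ K ∈ L, Function.update g H (-g H) K = g K := fun K hK =>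
    Function.update_of_ne (by rintro rfl; exact hH hK) _ _
  rw [hold, vertexCount, vertexCount, Finset.card_filter, Finset.card_filter, Finset.card_filter,
    ← Finset.sum_add_distrib, ← Finset.sum_add_distrib]
  refine Finset.even_sum _ fun σ hσ => ?_
  rw [Finset.mem_powersetCard] at hσ
  by_cases hS : colorType c σ = S
  swap
  · simp [hS]
  by_cases hHσ : H ∈ σ
  · have h : IsRegionFlat (insert H L) (Function.update g H (-g H)) σ ↔
        IsRegionFlat (insert H L) g σ := by
      refine exists_congr fun x => and_congr_right fun _ => forall₂_congr fun K hK => ?_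
      refine imp_congr_right fun hKσ => ?_
      rw [Function.update_of_ne (by rintro rfl; exact hKσ hHσ)]
    simp only [h, hHσ, hS]
    split_ifs <;> simp_all
  · obtain ⟨⟨x, hx⟩, -⟩ := hL.meet σ hσ.1 hσ.2.le
    have huniq : ∀ y, y ∈ flat σ ↔ y = x := fun y => by
      refine ⟨fun hy => sub_eq_zero.1 ?_, fun h => h ▸ hx⟩
      refine eq_zero_of_linear_eq_zero hL hg hσ.1 hσ.2 fun K hK => ?_
      rw [affineMap_linear_sub, (hg K (hσ.1 hK) y).1 (mem_flat.1 hy K hK),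
        (hg K (hσ.1 hK) x).1 (mem_flat.1 hx K hK), sub_zero]
    have hne := apply_ne_zero_of_notMem hL hg hσ.1 hσ.2 hx (Finset.mem_insert_self H L) hHσ
    have h0 : IsRegionFlat L g σ ↔ ∀ K ∈ L, K ∉ σ → 0 < g K x := by
      simp [IsRegionFlat, huniq]
    have h1 : IsRegionFlat (insert H L) g σ ↔ 0 < g H x ∧ IsRegionFlat L g σ := by
      rw [h0]
      simp [IsRegionFlat, huniq, hHσ]
    have h2 : IsRegionFlat (insert H L) (Function.update g H (-g H)) σ ↔
        g H x < 0 ∧ IsRegionFlat L g σ := by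
      rw [h0]
      simp only [IsRegionFlat, huniq, exists_eq_left, Finset.forall_mem_insert]
      refine and_congr (by simp [hHσ]) (forall₂_congr fun K hK => ?_)
      rw [hupd K hK]
    simp only [h1, h2, hHσ, hS]
    rcases lt_or_gt_of_ne hne with h | h
    · by_cases h3 : IsRegionFlat L g σ <;> simp [h, h3, h.not_gt]
    · by_cases h3 : IsRegionFlat L g σ <;> simp [h, h3, h.not_gt]

end

/-! ### The initial simplex -/

/-- The region cut out by the facets of a simplex is bounded. -/
theorem isBounded_setOf_forall_pos {E ι : Type*} [NormedAddCommGroup E] [NormedSpace ℝ E]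
    [Fintype ι] [DecidableEq ι] (a : ι → E →ᵃ[ℝ] ℝ) (x : ι → E) (o : ι)
    (hoff : ∀ i j, i ≠ j → a i (x j) = 0) (hdiag : ∀ i, 0 < a i (x i))
    (hinj : ∀ w : E, (∀ i, i ≠ o → (a i).linear w = 0) → w = 0) :
    Bornology.IsBounded {y | ∀ i, 0 < a i y} := by
  have hlin : ∀ i y z, (a i).linear (y - z) = a i y - a i z := fun i y z => by
    simpa using (a i).linearMap_vsub y z
  refine (Metric.isBounded_closedBall (x := x o) (r := ∑ j, ‖x j - x o‖)).subset fun y hy => ?_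
  have hy : ∀ i, 0 < a i y := hy
  -- These are the barycentric coordinates of `y`. They are positive, and those other than `m o` sum
  -- to less than `1` because `a o y` is positive.
  set m : ι → ℝ := fun j => a j y / a j (x j) with hm
  have hrep : y - x o = ∑ j ∈ Finset.univ.erase o, m j • (x j - x o) := by
    rw [← sub_eq_zero]
    refine hinj _ fun i hi => ?_
    rw [map_sub, map_sum, hlin, hoff i o hi, Finset.sum_eq_single i]
    · rw [map_smul, hlin, hoff i o hi, smul_eq_mul, sub_zero, sub_zero, hm,
        div_mul_cancel₀ _ (hdiag i).ne', sub_self]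
    · intro j _ hji
      rw [map_smul, hlin, hoff i o hi, hoff i j hji.symm]
      simp
    · intro h
      simp [hi] at h
  have hm0 : ∀ j, 0 < m j := fun j => div_pos (hy j) (hdiag j)
  have hsum : ∑ j ∈ Finset.univ.erase o, m j < 1 := by
    have h := hlin o y (x o)
    rw [hrep, map_sum, Finset.sum_congr rfl (g := fun j => m j * -(a o (x o))), ← Finset.sum_mul]
      at h
    · nlinarith [hy o, hdiag o]
    · intro j hj
      rw [map_smul, hlin, hoff o j (Finset.ne_of_mem_erase hj).symm, smul_eq_mul, zero_sub]
  rw [Metric.mem_closedBall, dist_eq_norm, hrep]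
  refine (norm_sum_le _ _).trans ((Finset.sum_le_sum fun j hj => ?_).trans
    (Finset.sum_le_sum_of_subset_of_nonneg (Finset.erase_subset _ _) fun _ _ _ => norm_nonneg _))
  rw [norm_smul, Real.norm_eq_abs, abs_of_pos (hm0 j)]
  have h1 : m j ≤ 1 :=
    (Finset.single_le_sum (f := m) (fun k _ => (hm0 k).le) hj).trans hsum.le
  exact mul_le_of_le_one_left (norm_nonneg _) h1

section

variable {d : ℕ} {L : Finset (AffineSubspace ℝ (Space d))}
  {g : AffineSubspace ℝ (Space d) → Space d →ᵃ[ℝ] ℝ}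

open Classical in
/-- `d + 1` hyperplanes of distinct colors bound a simplex, which has a single vertex of the type
that omits the color `0`. -/
theorem exists_orientation_simplex (H : Fin (d + 1) → AffineSubspace ℝ (Space d))
    (c : AffineSubspace ℝ (Space d) → Fin (d + 1)) (hcH : ∀ i, c (H i) = i)
    (hL : IsSimpleArrangement (Finset.univ.image H)) :
    ∃ g, IsOrientation (Finset.univ.image H) g ∧
      Bornology.IsBounded (positiveRegion (Finset.univ.image H) g) ∧
      vertexCount (Finset.univ.image H) g c (Finset.univ.erase 0).val = 1 := by
  have hinj : Function.Injective H := fun i j h => by rw [← hcH i, h, hcH j]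
  set L := Finset.univ.image H with hLdef
  have hmem : ∀ i, H i ∈ L := fun i => Finset.mem_image_of_mem H (Finset.mem_univ i)
  have hcard : ∀ i, (L.erase (H i)).card = d := fun i => by
    rw [Finset.card_erase_of_mem (hmem i), hLdef, Finset.card_image_of_injective _ hinj]
    simp
  have hsub : ∀ i, L.erase (H i) ⊆ L := fun i => Finset.erase_subset _ _
  -- `x i` is the vertex opposite to the facet on `H i`; the sign of each equation is chosen below
  -- to be positive there.
  choose x hx using fun i => (hL.meet (L.erase (H i)) (hsub i) (hcard i).le).1
  choose b hb using fun i => (hL.isHyperplane (H i) (hmem i)).exists_affineMap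
  have hbne : ∀ i, b i (x i) ≠ 0 := fun i => by
    have hor : IsOrientation L (fun K => b (c K)) := by
      intro K hK
      obtain ⟨j, -, rfl⟩ := Finset.mem_image.1 hK
      simp only [hcH]
      exact hb j
    have := apply_ne_zero_of_notMem hL hor (hsub i) (hcard i) (hx i) (hmem i)
      (Finset.notMem_erase _ _)
    simpa only [hcH] using this
  have hex : ∀ i, ∃ a : Space d →ᵃ[ℝ] ℝ, (∀ y, y ∈ H i ↔ a y = 0) ∧ 0 < a (x i) := fun i => by
    rcases lt_or_gt_of_ne (hbne i) with h | h
    · exact ⟨-b i, fun y => by rw [hb i]; simp, by simpa using h⟩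
    · exact ⟨b i, hb i, h⟩
  choose a ha hapos using hex
  have hg : IsOrientation L fun K => a (c K) := by
    intro K hK
    obtain ⟨j, -, rfl⟩ := Finset.mem_image.1 hK
    simp only [hcH]
    exact ha j
  refine ⟨fun K => a (c K), hg, ?_, ?_⟩
  · have hreg : positiveRegion L (fun K => a (c K)) = {y | ∀ i, 0 < a i y} := by
      ext y
      simp [positiveRegion, hLdef, hcH]
    rw [hreg]
    refine isBounded_setOf_forall_pos a x 0 (fun i j hij => ?_) hapos fun w hw => ?_
    · rw [← ha]
      exact mem_flat.1 (hx j) (H i) (Finset.mem_erase.2 ⟨fun h => hij (hinj h), hmem i⟩)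
    · refine eq_zero_of_linear_eq_zero hL hg (hsub 0) (hcard 0) fun K hK => ?_
      rw [Finset.mem_erase] at hK
      obtain ⟨hK0, hK⟩ := hK
      obtain ⟨j, -, rfl⟩ := Finset.mem_image.1 hK
      simp only [hcH]
      exact hw j fun h => hK0 (h ▸ rfl)
  · rw [vertexCount, Finset.card_eq_one]
    refine ⟨L.erase (H 0), ?_⟩
    ext σ
    simp only [Finset.mem_filter, Finset.mem_powersetCard, Finset.mem_singleton]
    constructor
    · rintro ⟨⟨hσ, hc⟩, -, hcol⟩
      -- The type lacks color `0`, so `σ` avoids `H 0` and must consist of all `d` other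
      -- hyperplanes.
      refine Finset.eq_of_subset_of_card_le (Finset.subset_erase.2 ⟨hσ, fun h => ?_⟩)
        (by rw [hcard, hc])
      have : c (H 0) ∈ colorType c σ := Multiset.mem_map_of_mem c h
      rw [hcol, hcH, Finset.mem_val] at this
      simp at this
    · rintro rfl
      refine ⟨⟨hsub 0, hcard 0⟩, ⟨x 0, hx 0, fun K hK hKσ => ?_⟩, ?_⟩
      · have : K = H 0 := by
          by_contra h
          exact hKσ (Finset.mem_erase.2 ⟨h, hK⟩)
        rw [this]
        simp only [hcH]
        exact hapos 0
      · have hL0 : L.erase (H 0) = (Finset.univ.erase 0).image H := by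
          rw [hLdef, Finset.image_erase hinj]
        rw [hL0, colorType, Finset.image_val_of_injOn hinj.injOn, Multiset.map_map]
        simp [Function.comp_def, hcH]

/-! ### Inserting hyperplanes and complete cells -/

theorem positiveRegion_subset {M : Finset (AffineSubspace ℝ (Space d))} (hM : L ⊆ M)
    {g' : AffineSubspace ℝ (Space d) → Space d →ᵃ[ℝ] ℝ} (hg' : ∀ H ∈ L, g' H = g H) :
    positiveRegion M g' ⊆ positiveRegion L g := fun x hx H hH => by
  rw [← hg' H hH]
  exact hx H (hM hH)

open Classical in
/-- Inserting a hyperplane splits a region into two; one of them keeps an odd vertex count. -/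
theorem exists_orientation_insert (c : AffineSubspace ℝ (Space d) → Fin (d + 1))
    (S : Multiset (Fin (d + 1))) {H : AffineSubspace ℝ (Space d)} (hH : H ∉ L)
    (hL : IsSimpleArrangement (insert H L)) (hg : IsOrientation L g)
    (hbd : Bornology.IsBounded (positiveRegion L g)) (hodd : Odd (vertexCount L g c S)) :
    ∃ g', IsOrientation (insert H L) g' ∧
      Bornology.IsBounded (positiveRegion (insert H L) g') ∧
      Odd (vertexCount (insert H L) g' c S) := by
  obtain ⟨a, ha⟩ := (hL.isHyperplane H (Finset.mem_insert_self _ _)).exists_affineMap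
  -- `g H` carries no information since `H ∉ L`; it is replaced by an equation of `H`, and `g₂` is
  -- the opposite orientation.
  set g₁ := Function.update g H a with hg₁
  set g₂ := Function.update g₁ H (-g₁ H) with hg₂
  have hne : ∀ K ∈ L, K ≠ H := by
    rintro K hK rfl
    exact hH hK
  have h₁ : ∀ K ∈ L, g₁ K = g K := fun K hK => Function.update_of_ne (hne K hK) _ _
  have h₂ : ∀ K ∈ L, g₂ K = g K := fun K hK => by
    rw [hg₂, Function.update_of_ne (hne K hK), h₁ K hK]
  have hor₁ : IsOrientation (insert H L) g₁ := by
    refine Finset.forall_mem_insert _ _ _ |>.2 ⟨fun x => ?_, fun K hK x => ?_⟩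
    · rw [hg₁, Function.update_self, ha]
    · rw [h₁ K hK, hg K hK]
  have hor₂ : IsOrientation (insert H L) g₂ := by
    refine Finset.forall_mem_insert _ _ _ |>.2 ⟨fun x => ?_, fun K hK x => ?_⟩
    · rw [hg₂, Function.update_self, hor₁ H (Finset.mem_insert_self _ _)]
      simp
    · rw [h₂ K hK, hg K hK]
  have hcount : vertexCount L g₁ c S = vertexCount L g c S := by
    rw [vertexCount, vertexCount]
    congr 1
    refine Finset.filter_congr fun σ _ => and_congr_left fun _ => ?_
    refine exists_congr fun x => and_congr_right fun _ => forall₂_congr fun K hK => ?_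
    rw [h₁ K hK]
  have heven := even_vertexCount_insert c S hH hL hor₁
  rw [hcount] at heven
  by_cases h : Odd (vertexCount (insert H L) g₁ c S)
  · exact ⟨g₁, hor₁, hbd.subset (positiveRegion_subset (Finset.subset_insert _ _) h₁), h⟩
  · refine ⟨g₂, hor₂, hbd.subset (positiveRegion_subset (Finset.subset_insert _ _) h₂), ?_⟩
    rw [Nat.even_add, Nat.even_add] at heven
    rw [← Nat.not_even_iff_odd] at h hodd ⊢
    tauto

theorem IsGoodType.exists_eq_erase {S : Multiset (Fin (d + 1))} (hS : IsGoodType S) :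
    ∃ i, S = (Finset.univ.erase i).val := by
  obtain ⟨hnd, hcard⟩ := hS
  set s : Finset (Fin (d + 1)) := ⟨S, hnd⟩ with hs
  have hc : sᶜ.card = 1 := by
    rw [Finset.card_compl, Fintype.card_fin, Finset.card_def, hs, hcard]
    omega
  obtain ⟨i, hi⟩ := Finset.card_eq_one.1 hc
  refine ⟨i, ?_⟩
  have : s = Finset.univ.erase i := by
    rw [← compl_compl s, hi]
    ext; simp
  rw [← this]

theorem isGoodType_erase (i : Fin (d + 1)) : IsGoodType (Finset.univ.erase i).val := by
  refine ⟨Finset.nodup _, ?_⟩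
  rw [← Finset.card_def, Finset.card_erase_of_mem (Finset.mem_univ i)]
  simp

/-- Odd parity spreads from the type omitting `0` to every good type. The odd count also provides a
vertex in the closure, which makes the region nonempty. -/
theorem isCompleteCell_positiveRegion (hd : 1 ≤ d) (hL : IsSimpleArrangement L)
    (hg : IsOrientation L g) (c : AffineSubspace ℝ (Space d) → Fin (d + 1))
    (hbd : Bornology.IsBounded (positiveRegion L g))
    (hodd : Odd (vertexCount L g c (Finset.univ.erase 0).val)) :
    IsCompleteCell L c (positiveRegion L g) := by
  classical
  refine ⟨isCell_positiveRegion hg ?_, hbd, fun S hS => ?_⟩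
  · obtain ⟨σ, hσ⟩ := Finset.card_pos.1 hodd.pos
    rw [Finset.mem_filter, Finset.mem_powersetCard] at hσ
    obtain ⟨⟨hσL, hc⟩, hv, -⟩ := hσ
    obtain ⟨x, -, hx⟩ := hv.exists_mem_closure hL hg hσL hc
    exact closure_nonempty_iff.1 ⟨x, hx⟩
  · rw [typeCount_positiveRegion hd hL hg c hS.2]
    obtain ⟨i, rfl⟩ := hS.exists_eq_erase
    by_cases h : i = 0
    · rwa [h]
    · have := even_vertexCount_add hL hg hbd c h
      rw [Nat.even_add] at this
      rwa [← Nat.not_even_iff_odd, this, Nat.not_even_iff_odd]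

theorem IsCompleteCell.exists_isBounding {c : AffineSubspace ℝ (Space d) → Fin (d + 1)}
    (hd : 1 ≤ d) {f : Set (Space d)} (hf : IsCompleteCell L c f) (i : Fin (d + 1)) :
    ∃ H ∈ L, IsBounding H f ∧ c H = i := by
  -- As `d ≥ 1`, there is a color `j ≠ i`, and the type omitting `j` contains `i`.
  have : Nontrivial (Fin (d + 1)) := Fin.nontrivial_iff_two_le.2 (by omega)
  obtain ⟨j, hj⟩ := exists_ne i
  obtain ⟨σ, hσ, hcol⟩ :=
    Set.nonempty_of_ncard_ne_zero (hf.2.2 _ (isGoodType_erase j)).pos.ne'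
  have hi : i ∈ colorType c σ := by
    rw [hcol, Finset.mem_val]
    exact Finset.mem_erase.2 ⟨hj.symm, Finset.mem_univ i⟩
  obtain ⟨H, hH, rfl⟩ := Multiset.mem_map.1 hi
  exact ⟨H, (hσ.2.1 H hH).1, (hσ.2.1 H hH).2, rfl⟩

end

theorem mainTheorem4 (d : ℕ) (hd : 1 ≤ d)
    (L : Finset (AffineSubspace ℝ (Space d))) (hL : IsSimpleArrangement L)
    (c : AffineSubspace ℝ (Space d) → Fin (d + 1))
    (hc : ∀ i : Fin (d + 1), ∃ H ∈ L, c H = i) :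
    (∃ f : Set (Space d), IsCompleteCell L c f) ∧
      ∀ f : Set (Space d), IsCompleteCell L c f →
        ∀ i : Fin (d + 1), ∃ H ∈ L, IsBounding H f ∧ c H = i := by
  classical
  refine ⟨?_, fun f hf => hf.exists_isBounding hd⟩
  choose H hHL hHc using hc
  set L₀ := Finset.univ.image H with hL₀
  have hsub : L₀ ⊆ L := Finset.image_subset_iff.2 fun i _ => hHL i
  -- The induction runs over `A ∪ L₀`, so it starts at the simplex `L₀`, skips hyperplanes already
  -- present, and yields `L` itself at `A = L`.
  have key : ∀ A ⊆ L, ∃ g, IsOrientation (A ∪ L₀) g ∧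
      Bornology.IsBounded (positiveRegion (A ∪ L₀) g) ∧
      Odd (vertexCount (A ∪ L₀) g c (Finset.univ.erase 0).val) := by
    intro A
    induction A using Finset.induction_on with
    | empty =>
      intro _
      rw [Finset.empty_union]
      obtain ⟨g, hg, hbd, h1⟩ := exists_orientation_simplex H c hHc (hL.mono hsub)
      exact ⟨g, hg, hbd, by rw [h1]; exact odd_one⟩
    | insert K A _ ih =>
      intro hKA
      obtain ⟨hK, hA⟩ := Finset.insert_subset_iff.1 hKA
      obtain ⟨g, hg, hbd, hodd⟩ := ih hA
      rw [Finset.insert_union]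
      by_cases hmem : K ∈ A ∪ L₀
      · rw [Finset.insert_eq_of_mem hmem]
        exact ⟨g, hg, hbd, hodd⟩
      · exact exists_orientation_insert c _ hmem
          (hL.mono (Finset.insert_subset hK (Finset.union_subset hA hsub))) hg hbd hodd
  obtain ⟨g, hg, hbd, hodd⟩ := key L subset_rfl
  rw [Finset.union_eq_left.2 hsub] at hg hbd hodd
  exact ⟨_, isCompleteCell_positiveRegion hd hL hg c hbd hodd⟩
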